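/- Fix an integer $K\ge 1$, a link function $f:\mathbb R\to\mathbb R$ and constants $C>0$, $C_3>0$. For $N$ persons and $J$ items let $\Theta^*=(\theta^*_{ik})\in\mathbb R^{N\times K}$ (rows $\theta_i^*$), $A^*=(a^*_{jk})\in\mathbb R^{J\times K}$ (rows $\mathbf a_j^*$) and $\mathbf d^*\in\mathbb R^J$ be the true (non-random) parameters, which may depend on $(N,J)$. Let $Y_{ij}\in\{0,1\}$ be independent with $P(Y_{ij}=1)=f(d_j^*+\mathbf a_j^{*\top}\theta_i^*)$, and let $W_{ij}\in\{0,1\}$ be independent of the family $(Y_{ij})$; $Y_{ij}$ is observed iff $W_{ij}=1$. Assume: A1. $\sqrt{1+\|\theta_i^*\|^2}\le C$ and $\sqrt{(d_j^*)^2+\|\mathbf a_j^*\|^2}\le C$ for all $i\le N$, $j\le J$. A2. $f$ is differentiable, and $\sup_{|x|\le C^2}\frac{|f'(x)|}{f(x)(1-f(x))}<\infty$, $\sup_{|x|\le C^2}\frac{f(x)(1-f(x))}{(f'(x))^2}<\infty$ (in particular $0<f<1$ and $f'\ne0$ on $|x|\le C^2$). A3. $\sum_i\theta^*_{ik}=0$,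 $\frac1N\sum_i(\theta^*_{ik})^2=1$ and $\sum_i\theta^*_{ik}\theta^*_{ik'}=0$ for all $k\ne k'$. A4. The $K$th (smallest) singular value of $A^*$ is at least $C_3\sqrt J$. A5. The $W_{ij}$ are i.i.d. Bernoulli with $P(W_{ij}=1)=\frac{n}{NJ}$ for some $n>0$ (which may depend on $(N,J)$). Assume further that $n\ge(N+J)\log(NJ)$. Let $(\hat\Theta,\hat A,\hat{\mathbf d})$ be a constrained joint maximum likelihood estimate, i.e. any maximizer of $$\log\prod_{i,j:\,W_{ij}=1}f(d_j+\mathbf a_j^\top\theta_i)^{Y_{ij}}\bigl(1-f(d_j+\mathbf a_j^\top\theta_i)\bigr)^{1-Y_{ij}}$$ subject to $\sqrt{1+\|\theta_i\|^2}\le C$ and $\sqrt{d_j^2+\|\mathbf a_j\|^2}\le C$ for all $i,j$. Let $(\tilde\Theta,\tilde A,\tilde{\mathbf d})$ be a standardized version of it, i.e. $\tilde\Theta\tilde A^\top+\mathbf 1_N\tilde{\mathbf d}^\top=\hat\Theta\hat A^\top+\mathbf 1_N\hat{\mathbf d}^\top$ and $\tilde\Theta$ satisfies the constraints of A3. Then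 $$\min_{Q\in\mathbb R^{K\times K}}\Bigl\{\frac1{JK}\|A^*-\tilde AQ\|_F^2:\ Q^\top Q=I_{K\times K}\Bigr\}$$ converges to zero in probability as $N,J\to\infty$. That is, along any sequence (or net) of such models, with $K,f,C,C_3$ fixed and $N\to\infty$, $J\to\infty$, for every $\varepsilon>0$ the probability that this minimum is at least $\varepsilon$ tends to $0$. -/

import Mathlib

open MeasureTheory ProbabilityTheory Filter Topology
open scoped Matrix

noncomputable section

namespace IFA

/-- The parameters of a `K`-factor model for `N` persons and `J` items: the person parameters
`Θ = (θ_{ik})`, the loading matrix `A = (a_{jk})` and the intercepts `d = (d_j)`. -/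
structure Params (N J K : ℕ) where
  Θ : Matrix (Fin N) (Fin K) ℝ
  A : Matrix (Fin J) (Fin K) ℝ
  d : Fin J → ℝ

/-- The linear predictor `d_j + a_jᵀ θ_i`, i.e. the `(i, j)` entry of `Θ Aᵀ + 1_N dᵀ`. -/
def Params.linPred {N J K : ℕ} (p : Params N J K) (i : Fin N) (j : Fin J) : ℝ :=
  p.d j + p.A j ⬝ᵥ p.Θ i

/-- The norm constraints `√(1 + ‖θ_i‖²) ≤ C` and `√(d_j² + ‖a_j‖²) ≤ C` for all `i`, `j`,
with Euclidean norms. -/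
def Params.Feasible {N J K : ℕ} (C : ℝ) (p : Params N J K) : Prop :=
  (∀ i, √(1 + ∑ k, p.Θ i k ^ 2) ≤ C) ∧ (∀ j, √(p.d j ^ 2 + ∑ k, p.A j k ^ 2) ≤ C)

/-- The joint likelihood of the observed responses: the product over the pairs `(i, j)` with
`w i j = 1` of `f(d_j + a_jᵀ θ_i) ^ y_ij * (1 - f(d_j + a_jᵀ θ_i)) ^ (1 - y_ij)`. -/
def likelihood {N J K : ℕ} (f : ℝ → ℝ) (y w : Fin N → Fin J → Bool) (p : Params N J K) : ℝ :=
  ∏ i, ∏ j, if w i j then (if y i j then f (p.linPred i j) else 1 - f (p.linPred i j)) else 1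

/-- `p` is a constrained joint maximum likelihood estimate from the data `(y, w)`: a maximizer of
the joint log-likelihood over the feasible set. -/
def IsCJMLE {N J K : ℕ} (f : ℝ → ℝ) (C : ℝ) (y w : Fin N → Fin J → Bool)
    (p : Params N J K) : Prop :=
  p.Feasible C ∧
    ∀ q : Params N J K, q.Feasible C →
      Real.log (likelihood f y w q) ≤ Real.log (likelihood f y w p)

/-- The smoothness condition on the link function: `f` is differentiable and, on `|x| ≤ C²`, the
two quotients `|f'| / (f (1 - f))` and `f (1 - f) / (f')²` are well defined and bounded. -/
structure LinkRegular (f : ℝ → ℝ) (C : ℝ) : Prop where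
  differentiable : Differentiable ℝ f
  pos : ∀ x, |x| ≤ C ^ 2 → 0 < f x
  lt_one : ∀ x, |x| ≤ C ^ 2 → f x < 1
  deriv_ne_zero : ∀ x, |x| ≤ C ^ 2 → deriv f x ≠ 0
  bdd₁ : ∃ B : ℝ, ∀ x, |x| ≤ C ^ 2 → |deriv f x| / (f x * (1 - f x)) ≤ B
  bdd₂ : ∃ B : ℝ, ∀ x, |x| ≤ C ^ 2 → f x * (1 - f x) / (deriv f x) ^ 2 ≤ B

/-- The columns of `Θ` sum to zero, have mean square one, and are mutually orthogonal. -/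
structure Identified {N K : ℕ} (Θ : Matrix (Fin N) (Fin K) ℝ) : Prop where
  sum_eq_zero : ∀ k, ∑ i, Θ i k = 0
  mean_sq_eq_one : ∀ k, (1 / (N : ℝ)) * ∑ i, Θ i k * Θ i k = 1
  orthogonal : ∀ k k', k ≠ k' → ∑ i, Θ i k * Θ i k' = 0

/-- `p'` is a standardized version of `p`: the same matrix `Θ Aᵀ + 1_N dᵀ`, reparametrized so that
the person parameters of `p'` satisfy the identification constraints. -/
def IsStandardization {N J K : ℕ} (p p' : Params N J K) : Prop :=
  Identified p'.Θ ∧ ∀ i j, p'.linPred i j = p.linPred i j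

/-- The `K`-th largest (that is, the smallest) singular value of a `J × K` matrix. Mathlib numbers
the singular values from `0`, in decreasing order. -/
def sigmaK {J K : ℕ} (A : Matrix (Fin J) (Fin K) ℝ) : ℝ :=
  (Matrix.toEuclideanLin A).singularValues (K - 1)

/-- The Frobenius norm. -/
def frobNorm {m n : ℕ} (X : Matrix (Fin m) (Fin n) ℝ) : ℝ :=
  √(∑ i, ∑ j, X i j ^ 2)

/-- The scaled Frobenius loss `min {(1/(JK)) ‖A - B Q‖_F² : Qᵀ Q = I}`. It is an infimum of a
continuous function over the nonempty compact set of orthogonal matrices, hence a minimum. -/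
def loss {J K : ℕ} (A B : Matrix (Fin J) (Fin K) ℝ) : ℝ :=
  ⨅ Q : {Q : Matrix (Fin K) (Fin K) ℝ // Qᵀ * Q = 1},
    (1 / ((J : ℝ) * (K : ℝ))) * frobNorm (A - B * Q.1) ^ 2

/-- The `Y_ij` are independent binary responses with `P(Y_ij = 1) = f(d_j + a_jᵀ θ_i)`, the
`W_ij` are i.i.d. Bernoulli with `P(W_ij = 1) = n / (N J)`, and the family `W` is independent of
the family `Y` (responses missing completely at random). -/
structure IsDataModel {Ω : Type*} [MeasurableSpace Ω] (P : Measure Ω) {N J K : ℕ} (f : ℝ → ℝ)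
    (p : Params N J K) (n : ℝ) (Y W : Ω → Fin N → Fin J → Bool) : Prop where
  measurable_Y : ∀ i j, Measurable (fun ω => Y ω i j)
  measurable_W : ∀ i j, Measurable (fun ω => W ω i j)
  indep_Y : iIndepFun (fun (ij : Fin N × Fin J) ω => Y ω ij.1 ij.2) P
  indep_W : iIndepFun (fun (ij : Fin N × Fin J) ω => W ω ij.1 ij.2) P
  indep_Y_W : IndepFun Y W P
  prob_Y : ∀ i j, P.real {ω | Y ω i j = true} = f (p.linPred i j)
  prob_W : ∀ i j, P.real {ω | W ω i j = true} = n / ((N : ℝ) * (J : ℝ))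

end IFA

end

noncomputable section

namespace IFA

/-! The proof has a probabilistic half and a deterministic half.

Probabilistic half (`exists_measureReal_sum_sq_ge_le`): the estimate recovers the whole matrix of
linear predictors in mean square. A fixed alternative `q` is almost as likely as the truth only with
probability at most `exp(-r n)` when its predictors are far away in mean square: apply Markov's
inequality to the square root of the likelihood ratio, whose mean is a product of Hellinger
affinities. The feasible set has a sup-norm net, in the predictors, of size `s ^ (N + J)`, and
log-probabilities are Lipschitz in the predictor, so a union bound over the net controls the
maximizer. Since `n` dominates `(N + J) log(NJ)`, the product `s ^ (N + J) * exp(-r n)` vanishes.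

Deterministic half (`exists_loss_lt`): put `R = N⁻¹ Θ̃ᵀ Θ*`. Multiplying the predictor matrices by
`Θ*` or `Θ̃` kills the intercepts and gives `A* ≈ Ã R` and `Ã ≈ A* Rᵀ`. Hence `A* (1 - Rᵀ R) ≈ 0`;
the lower bound on the smallest singular value of `A*` forces `Rᵀ R ≈ 1`, and `R` is close to an
orthogonal `Q`. -/

/-! ### Scalar inequalities for Bernoulli laws and the link function. -/

/-- The left side is the Hellinger affinity of two Bernoulli laws, at most `1 - (√a - √b)² / 2`; and
`|a - b| ≤ 2 |√a - √b|` because `√a + √b ≤ 2`. -/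
theorem sqrt_mul_sqrt_add_le {a b : ℝ} (ha : 0 < a) (ha1 : a < 1) (hb : 0 < b) (hb1 : b < 1) :
    √a * √b + √(1 - a) * √(1 - b) ≤ 1 - (a - b) ^ 2 / 8 := by
  have h1 := Real.sq_sqrt ha.le
  have h2 := Real.sq_sqrt hb.le
  have h3 := Real.sq_sqrt (sub_nonneg.2 ha1.le)
  have h4 := Real.sq_sqrt (sub_nonneg.2 hb1.le)
  have h5 : √a ≤ 1 := Real.sqrt_le_one.2 ha1.le
  have h6 : √b ≤ 1 := Real.sqrt_le_one.2 hb1.le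
  have p1 := Real.sqrt_nonneg a
  have p2 := Real.sqrt_nonneg b
  have key : (a - b) ^ 2 ≤ 4 * (√a - √b) ^ 2 := by
    have : a - b = (√a - √b) * (√a + √b) := by linear_combination -h1 + h2
    rw [this, mul_pow, mul_comm]
    gcongr
    nlinarith
  nlinarith [sq_nonneg (√(1 - a) - √(1 - b))]

/-- The success probability or its complement. -/
def bernProb (a : ℝ) (y : Bool) : ℝ := if y then a else 1 - a

theorem bernProb_pos {a : ℝ} (h0 : 0 < a) (h1 : a < 1) (y : Bool) : 0 < bernProb a y := by
  cases y <;> simp [bernProb, h0, h1]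

/-- Along an interval, a function with nonvanishing bounded-below derivative separates points. -/
theorem mul_abs_sub_le_of_le_abs_deriv {f : ℝ → ℝ} (hf : Differentiable ℝ f) {r c : ℝ}
    (h : ∀ x, |x| ≤ r → c ≤ |deriv f x|) {x y : ℝ} (hx : |x| ≤ r) (hy : |y| ≤ r) :
    c * |x - y| ≤ |f x - f y| := by
  wlog hxy : y < x generalizing x y
  · rcases (not_lt.1 hxy).eq_or_lt with rfl | h'
    · simp
    · rw [abs_sub_comm x, abs_sub_comm (f x)]
      exact this hy hx h'
  obtain ⟨z, hz, hz'⟩ := exists_deriv_eq_slope f hxy hf.continuous.continuousOn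
    hf.differentiableOn
  have hzr : |z| ≤ r := by
    rw [abs_le] at *
    exact ⟨hy.1.trans hz.1.le, hz.2.le.trans hx.2⟩
  have := h z hzr
  rw [hz', abs_div, le_div_iff₀ (abs_pos.2 (sub_pos.2 hxy).ne')] at this
  exact this

/-- The derivative need not be continuous, so `|f'|` is bounded below indirectly: `f (1 - f)` has a
positive minimum by compactness, and `bdd₂` transfers it to `(f')²`. -/
theorem LinkRegular.exists_mul_abs_sub_le {f : ℝ → ℝ} {C : ℝ} (hf : LinkRegular f C) :
    ∃ c > 0, ∀ x y, |x| ≤ C ^ 2 → |y| ≤ C ^ 2 → c * |x - y| ≤ |f x - f y| := by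
  obtain ⟨B, hB⟩ := hf.bdd₂
  have hne : (Set.Icc (-(C ^ 2)) (C ^ 2)).Nonempty :=
    ⟨0, by constructor <;> linarith [sq_nonneg C]⟩
  have hcont : Continuous fun x => f x * (1 - f x) :=
    hf.differentiable.continuous.mul (continuous_const.sub hf.differentiable.continuous)
  obtain ⟨x₀, hx₀, hmin⟩ := isCompact_Icc.exists_isMinOn hne hcont.continuousOn
  set v := f x₀ * (1 - f x₀) with hv
  have hvpos : 0 < v :=
    mul_pos (hf.pos _ (abs_le.2 hx₀)) (sub_pos.2 (hf.lt_one _ (abs_le.2 hx₀)))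
  set B' := max B 1
  have hB' : 0 < B' := lt_max_of_lt_right one_pos
  refine ⟨√(v / B'), Real.sqrt_pos.2 (by positivity), fun x y hx hy =>
    mul_abs_sub_le_of_le_abs_deriv hf.differentiable (fun z hz => ?_) hx hy⟩
  have hd : 0 < deriv f z ^ 2 := by have := hf.deriv_ne_zero z hz; positivity
  have h1 : f z * (1 - f z) / deriv f z ^ 2 ≤ B' := (hB z hz).trans (le_max_left _ _)
  have h2 : v ≤ f z * (1 - f z) := hmin (abs_le.1 hz)
  rw [div_le_iff₀ hd] at h1
  rw [← Real.sqrt_sq_eq_abs]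
  apply Real.sqrt_le_sqrt
  rw [div_le_iff₀ hB']
  linarith

theorem le_mul_exp_of_abs_deriv_le {g : ℝ → ℝ} (hg : Differentiable ℝ g) {r B : ℝ}
    (hpos : ∀ x, |x| ≤ r → 0 < g x) (hB : ∀ x, |x| ≤ r → |deriv g x| ≤ B * g x)
    {x y : ℝ} (hx : |x| ≤ r) (hy : |y| ≤ r) : g x ≤ g y * Real.exp (B * |x - y|) := by
  have hmem : ∀ z, z ∈ Set.Icc (-r) r ↔ |z| ≤ r := fun z => abs_le.symm
  have key := Convex.norm_image_sub_le_of_norm_hasDerivWithin_le (𝕜 := ℝ)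
    (f := fun z => Real.log (g z)) (f' := fun z => deriv g z / g z) (s := Set.Icc (-r) r) (C := B)
    (x := y) (y := x)
    (fun z hz => ((hg z).hasDerivAt.log (hpos z ((hmem z).1 hz)).ne').hasDerivWithinAt)
    (fun z hz => by
      have h := hpos z ((hmem z).1 hz)
      rw [norm_div, Real.norm_eq_abs, Real.norm_eq_abs, abs_of_pos h, div_le_iff₀ h]
      exact hB z ((hmem z).1 hz))
    (convex_Icc _ _) ((hmem y).2 hy) ((hmem x).2 hx)
  have h1 : Real.log (g x) ≤ Real.log (g y) + B * |x - y| := by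
    have := (le_abs_self _).trans key
    simp only [Real.norm_eq_abs] at this
    linarith
  calc g x = Real.exp (Real.log (g x)) := (Real.exp_log (hpos x hx)).symm
    _ ≤ Real.exp (Real.log (g y) + B * |x - y|) := Real.exp_le_exp.2 h1
    _ = _ := by rw [Real.exp_add, Real.exp_log (hpos y hy)]

/-- Both `log f` and `log (1 - f)` are Lipschitz on `|x| ≤ C²`, since `f (1 - f)` is at most either
factor. -/
theorem LinkRegular.exists_bernProb_le {f : ℝ → ℝ} {C : ℝ} (hf : LinkRegular f C) :
    ∃ B ≥ 0, ∀ x y b, |x| ≤ C ^ 2 → |y| ≤ C ^ 2 →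
      bernProb (f x) b ≤ bernProb (f y) b * Real.exp (B * |x - y|) := by
  obtain ⟨B, hB⟩ := hf.bdd₁
  have hB0 : 0 ≤ B := by
    refine le_trans ?_ (hB 0 (by simp [sq_nonneg]))
    have h0 : |(0 : ℝ)| ≤ C ^ 2 := by simp [sq_nonneg]
    have := hf.pos 0 h0
    have := sub_pos.2 (hf.lt_one 0 h0)
    positivity
  have hB' : ∀ x, |x| ≤ C ^ 2 → |deriv f x| ≤ B * (f x * (1 - f x)) := fun x hx =>
    (div_le_iff₀ (mul_pos (hf.pos x hx) (sub_pos.2 (hf.lt_one x hx)))).1 (hB x hx)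
  refine ⟨B, hB0, fun x y b hx hy => ?_⟩
  cases b
  · simp only [bernProb, Bool.false_eq_true, if_false]
    refine le_mul_exp_of_abs_deriv_le (g := fun x => 1 - f x) (hf.differentiable.const_sub 1)
      (fun z hz => sub_pos.2 (hf.lt_one z hz)) (fun z hz => ?_) hx hy
    rw [deriv_const_sub, abs_neg]
    refine (hB' z hz).trans (mul_le_mul_of_nonneg_left ?_ hB0)
    nlinarith [hf.pos z hz, hf.lt_one z hz]
  · simp only [bernProb, if_true]
    refine le_mul_exp_of_abs_deriv_le hf.differentiable hf.pos (fun z hz => ?_) hx hy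
    refine (hB' z hz).trans (mul_le_mul_of_nonneg_left ?_ hB0)
    nlinarith [hf.pos z hz, hf.lt_one z hz]

/-! ### The finite joint law of the data. -/

section DataModel

variable {Ω : Type*} [MeasurableSpace Ω] {P : Measure Ω} {N J K : ℕ}
  {f : ℝ → ℝ} {p : Params N J K} {n : ℝ} {Y W : Ω → Fin N → Fin J → Bool}

theorem measureReal_eq_bernProb [IsProbabilityMeasure P] {X : Ω → Bool} (hX : Measurable X) {a : ℝ}
    (h : P.real {ω | X ω = true} = a) (b : Bool) : P.real {ω | X ω = b} = bernProb a b := by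
  cases b
  · have : {ω | X ω = false} = {ω | X ω = true}ᶜ := by ext; simp
    have hm : MeasurableSet {ω | X ω = true} := hX (measurableSet_singleton true)
    rw [this, probReal_compl_eq_one_sub hm, h]
    simp [bernProb]
  · simp [bernProb, h]

theorem measureReal_forall_eq_of_iIndepFun {κ : Type*} [Fintype κ] {X : κ → Ω → Bool}
    (h : iIndepFun X P) (b : κ → Bool) :
    P.real {ω | ∀ k, X k ω = b k} = ∏ k, P.real {ω | X k ω = b k} := by
  have h1 : {ω | ∀ k, X k ω = b k} = ⋂ k, X k ⁻¹' {b k} := by ext; simp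
  rw [h1, measureReal_def, h.meas_iInter (fun k => ⟨{b k}, measurableSet_singleton _, rfl⟩),
    ENNReal.toReal_prod]
  rfl

/-- The joint law of the responses and the observation indicators. -/
theorem IsDataModel.measureReal_forall_eq [IsProbabilityMeasure P] (h : IsDataModel P f p n Y W)
    (y w : Fin N × Fin J → Bool) :
    P.real {ω | ∀ ij, Y ω ij.1 ij.2 = y ij ∧ W ω ij.1 ij.2 = w ij} =
      ∏ ij : Fin N × Fin J, bernProb (f (p.linPred ij.1 ij.2)) (y ij) *
        bernProb (n / ((N : ℝ) * (J : ℝ))) (w ij) := by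
  have h1 : {ω | ∀ ij : Fin N × Fin J, Y ω ij.1 ij.2 = y ij ∧ W ω ij.1 ij.2 = w ij} =
      Y ⁻¹' {fun i j => y (i, j)} ∩ W ⁻¹' {fun i j => w (i, j)} := by
    ext ω
    simp only [Set.mem_ofPred_eq, Set.mem_inter_iff, Set.mem_preimage, Set.mem_singleton_iff,
      funext_iff, Prod.forall]
    exact ⟨fun h => ⟨fun i j => (h i j).1, fun i j => (h i j).2⟩,
      fun h i j => ⟨h.1 i j, h.2 i j⟩⟩
  have h2 : ∀ (X : Ω → Fin N → Fin J → Bool) (x : Fin N × Fin J → Bool),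
      X ⁻¹' {fun i j => x (i, j)} = {ω | ∀ ij : Fin N × Fin J, X ω ij.1 ij.2 = x ij} := by
    intro X x
    ext ω
    simp [funext_iff]
  rw [h1, measureReal_def, h.indep_Y_W.measure_inter_preimage_eq_mul _ _
    (measurableSet_singleton _) (measurableSet_singleton _), ENNReal.toReal_mul, h2, h2,
    Finset.prod_mul_distrib]
  have e1 := measureReal_forall_eq_of_iIndepFun h.indep_Y y
  have e2 := measureReal_forall_eq_of_iIndepFun h.indep_W w
  simp only [measureReal_def] at e1 e2
  rw [e1, e2]
  congr 1
  · exact Finset.prod_congr rfl fun ij _ =>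
      measureReal_eq_bernProb (h.measurable_Y _ _) (h.prob_Y _ _) _
  · exact Finset.prod_congr rfl fun ij _ =>
      measureReal_eq_bernProb (h.measurable_W _ _) (h.prob_W _ _) _

/-- Markov's inequality for a product of functions of the individual observations. -/
theorem IsDataModel.measureReal_le_prod [IsProbabilityMeasure P] (h : IsDataModel P f p n Y W)
    (G : Fin N × Fin J → Bool → Bool → ℝ) (hG : ∀ ij a b, 0 ≤ G ij a b)
    (S : Set Ω) (hS : ∀ ω ∈ S, 1 ≤ ∏ ij, G ij (Y ω ij.1 ij.2) (W ω ij.1 ij.2)) :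
    P.real S ≤ ∏ ij : Fin N × Fin J, ∑ z : Bool × Bool,
      bernProb (f (p.linPred ij.1 ij.2)) z.1 * bernProb (n / ((N : ℝ) * (J : ℝ))) z.2 *
        G ij z.1 z.2 := by
  classical
  set E : (Fin N × Fin J → Bool × Bool) → Set Ω := fun z =>
    {ω | ∀ ij, Y ω ij.1 ij.2 = (z ij).1 ∧ W ω ij.1 ij.2 = (z ij).2} with hE
  set A : Finset (Fin N × Fin J → Bool × Bool) :=
    Finset.univ.filter fun z => 1 ≤ ∏ ij, G ij (z ij).1 (z ij).2
  -- `S` need not be measurable, as the estimator is an arbitrary function of `ω`; it is covered by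
  -- finitely many elementary events instead.
  have hsub : S ⊆ ⋃ z ∈ A, E z := by
    intro ω hω
    simp only [Set.mem_iUnion]
    exact ⟨fun ij => (Y ω ij.1 ij.2, W ω ij.1 ij.2), by simpa [A] using hS ω hω,
      fun ij => ⟨rfl, rfl⟩⟩
  have hEval : ∀ z, P.real (E z) = ∏ ij : Fin N × Fin J,
      bernProb (f (p.linPred ij.1 ij.2)) (z ij).1 *
        bernProb (n / ((N : ℝ) * (J : ℝ))) (z ij).2 := fun z =>
    h.measureReal_forall_eq (fun ij => (z ij).1) fun ij => (z ij).2
  calc P.real S ≤ P.real (⋃ z ∈ A, E z) := measureReal_mono hsub (measure_ne_top _ _)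
    _ ≤ ∑ z ∈ A, P.real (E z) := measureReal_biUnion_finset_le _ _
    _ ≤ ∑ z ∈ A, P.real (E z) * ∏ ij, G ij (z ij).1 (z ij).2 := by
        refine Finset.sum_le_sum fun z hz => le_mul_of_one_le_right measureReal_nonneg ?_
        simpa [A] using hz
    _ ≤ ∑ z, P.real (E z) * ∏ ij, G ij (z ij).1 (z ij).2 :=
        Finset.sum_le_sum_of_subset_of_nonneg (Finset.subset_univ _) fun z _ _ =>
          mul_nonneg measureReal_nonneg (Finset.prod_nonneg fun ij _ => hG _ _ _)
    _ = _ := by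
        simp_rw [hEval, ← Finset.prod_mul_distrib]
        rw [Finset.prod_univ_sum, Fintype.piFinset_univ]

end DataModel

/-! ### Likelihood comparison and the Hellinger bound. -/

section Likelihood

variable {N J K : ℕ}

theorem Params.Feasible.abs_linPred_le {C : ℝ} (hC : 0 < C) {p : Params N J K}
    (h : p.Feasible C) (i : Fin N) (j : Fin J) : |p.linPred i j| ≤ C ^ 2 := by
  have h1 := (Real.sqrt_le_left hC.le).1 (h.1 i)
  have h2 := (Real.sqrt_le_left hC.le).1 (h.2 j)
  have hcs : p.linPred i j ^ 2 ≤
      (p.d j ^ 2 + ∑ k, p.A j k ^ 2) * (1 + ∑ k, p.Θ i k ^ 2) := by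
    -- Cauchy–Schwarz for `(d_j, a_j)` and `(1, θ_i)`, with `none` indexing the intercept.
    have := Finset.sum_mul_sq_le_sq_mul_sq Finset.univ
      (fun o : Option (Fin K) => o.elim (p.d j) (p.A j))
      (fun o : Option (Fin K) => o.elim 1 (p.Θ i))
    simpa [Fintype.sum_option, Params.linPred, dotProduct] using this
  apply abs_le_of_sq_le_sq _ (by positivity)
  refine hcs.trans ?_
  rw [sq (C ^ 2)]
  refine mul_le_mul h2 h1 ?_ (by positivity)
  have := Finset.sum_nonneg (s := Finset.univ) fun k _ => sq_nonneg (p.Θ i k)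
  linarith

theorem likelihood_eq_prod (f : ℝ → ℝ) (y w : Fin N → Fin J → Bool) (p : Params N J K) :
    likelihood f y w p = ∏ ij : Fin N × Fin J,
      if w ij.1 ij.2 then bernProb (f (p.linPred ij.1 ij.2)) (y ij.1 ij.2) else 1 := by
  rw [Fintype.prod_prod_type]
  rfl

theorem likelihood_pos {f : ℝ → ℝ} {C : ℝ} (hC : 0 < C) (hf : LinkRegular f C)
    (y w : Fin N → Fin J → Bool) {p : Params N J K} (h : p.Feasible C) :
    0 < likelihood f y w p := by
  rw [likelihood_eq_prod]
  refine Finset.prod_pos fun ij _ => ?_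
  split_ifs
  · exact bernProb_pos (hf.pos _ (h.abs_linPred_le hC _ _)) (hf.lt_one _ (h.abs_linPred_le hC _ _)) _
  · exact one_pos

/-- The factor by which the likelihood can change when every observed log-probability moves by at
most `κ`. -/
def slack (κ : ℝ) (w : Fin N → Fin J → Bool) : ℝ :=
  ∏ ij : Fin N × Fin J, if w ij.1 ij.2 then Real.exp κ else 1

theorem likelihood_le_mul_slack {f : ℝ → ℝ} {C B δ : ℝ} (hC : 0 < C) (hf : LinkRegular f C)
    (hB0 : 0 ≤ B)
    (hB : ∀ x y b, |x| ≤ C ^ 2 → |y| ≤ C ^ 2 →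
      bernProb (f x) b ≤ bernProb (f y) b * Real.exp (B * |x - y|))
    (y w : Fin N → Fin J → Bool) {p q : Params N J K} (hp : p.Feasible C) (hq : q.Feasible C)
    (h : ∀ i j, |p.linPred i j - q.linPred i j| ≤ δ) :
    likelihood f y w p ≤ likelihood f y w q * slack (B * δ) w := by
  rw [likelihood_eq_prod, likelihood_eq_prod, slack, ← Finset.prod_mul_distrib]
  have hpos : ∀ {r : Params N J K}, r.Feasible C → ∀ ij : Fin N × Fin J, ∀ b,
      0 < bernProb (f (r.linPred ij.1 ij.2)) b := fun hr ij b =>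
    bernProb_pos (hf.pos _ (hr.abs_linPred_le hC _ _)) (hf.lt_one _ (hr.abs_linPred_le hC _ _)) _
  refine Finset.prod_le_prod (fun ij _ => ?_) fun ij _ => ?_
  · split_ifs
    · exact (hpos hp ij _).le
    · exact zero_le_one
  · split_ifs
    · refine (hB _ _ _ (hp.abs_linPred_le hC _ _) (hq.abs_linPred_le hC ij.1 ij.2)).trans ?_
      refine mul_le_mul_of_nonneg_left ?_ (hpos hq ij _).le
      exact Real.exp_le_exp.2 (mul_le_mul_of_nonneg_left (h _ _) hB0)
    · simp

variable {Ω : Type*} [MeasurableSpace Ω] {P : Measure Ω} {f : ℝ → ℝ} {p q : Params N J K} {n : ℝ}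
  {Y W : Ω → Fin N → Fin J → Bool}

/-- The Hellinger (Chernoff) bound on the probability that a fixed alternative is almost as likely
as the truth. -/
theorem IsDataModel.measureReal_likelihood_le [IsProbabilityMeasure P]
    (h : IsDataModel P f p n Y W) (hn : 0 < n)
    {C c κ : ℝ} (hC : 0 < C) (hf : LinkRegular f C) (hc0 : 0 ≤ c)
    (hc : ∀ x y, |x| ≤ C ^ 2 → |y| ≤ C ^ 2 → c * |x - y| ≤ |f x - f y|)
    (hκ : 0 ≤ κ) (hp : p.Feasible C) (hq : q.Feasible C) :
    P.real {ω | likelihood f (Y ω) (W ω) p ≤ likelihood f (Y ω) (W ω) q * slack κ (W ω)} ≤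
      Real.exp (n / ((N : ℝ) * (J : ℝ)) * ∑ ij : Fin N × Fin J,
        (Real.exp (κ / 2) - 1 -
          c ^ 2 / 8 * (q.linPred ij.1 ij.2 - p.linPred ij.1 ij.2) ^ 2)) := by
  have hpos : ∀ {r : Params N J K}, r.Feasible C → ∀ ij : Fin N × Fin J, ∀ b,
      0 < bernProb (f (r.linPred ij.1 ij.2)) b := fun hr ij b =>
    bernProb_pos (hf.pos _ (hr.abs_linPred_le hC _ _)) (hf.lt_one _ (hr.abs_linPred_le hC _ _)) _
  set ρ := n / ((N : ℝ) * (J : ℝ)) with hρ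
  have hρ0 : 0 ≤ ρ := by positivity
  -- `G` is the square root of the likelihood ratio of one cell, slack included, so its product is
  -- at least 1 on the event.
  let G : Fin N × Fin J → Bool → Bool → ℝ := fun ij a b =>
    if b then √(bernProb (f (q.linPred ij.1 ij.2)) a) / √(bernProb (f (p.linPred ij.1 ij.2)) a) *
      Real.exp (κ / 2) else 1
  have hG0 : ∀ ij a b, 0 ≤ G ij a b := by
    intro ij a b
    simp only [G]
    split_ifs <;> positivity
  have hexp : Real.exp (κ / 2) ^ 2 = Real.exp κ := by rw [← Real.exp_nat_mul]; congr 1; push_cast; ring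
  refine (h.measureReal_le_prod G hG0 _ fun ω hω => ?_).trans ?_
  · have hLp := likelihood_pos hC hf (Y ω) (W ω) hp
    have hGnn : 0 ≤ ∏ ij, G ij (Y ω ij.1 ij.2) (W ω ij.1 ij.2) :=
      Finset.prod_nonneg fun ij _ => hG0 _ _ _
    have key : likelihood f (Y ω) (W ω) p * (∏ ij, G ij (Y ω ij.1 ij.2) (W ω ij.1 ij.2)) ^ 2 =
        likelihood f (Y ω) (W ω) q * slack κ (W ω) := by
      rw [likelihood_eq_prod, likelihood_eq_prod, slack, ← Finset.prod_pow,
        ← Finset.prod_mul_distrib, ← Finset.prod_mul_distrib]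
      refine Finset.prod_congr rfl fun ij _ => ?_
      simp only [G]
      split_ifs
      · have h1 := hpos hp ij (Y ω ij.1 ij.2)
        have h2 := hpos hq ij (Y ω ij.1 ij.2)
        rw [mul_pow, div_pow, Real.sq_sqrt h1.le, Real.sq_sqrt h2.le, hexp]
        field_simp
      · simp
    have hω' : likelihood f (Y ω) (W ω) p ≤ likelihood f (Y ω) (W ω) q * slack κ (W ω) := hω
    rw [← key] at hω'
    have := (le_mul_iff_one_le_right hLp).1 hω'
    exact (one_le_sq_iff₀ hGnn).1 this
  · rw [Finset.mul_sum, Real.exp_sum]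
    refine Finset.prod_le_prod (fun ij _ => Finset.sum_nonneg fun z _ => ?_) fun ij _ => ?_
    · refine mul_nonneg (mul_nonneg (hpos hp ij _).le ?_) (hG0 _ _ _)
      -- That `1 - ρ ≥ 0` is read off from its being a probability.
      rw [← measureReal_eq_bernProb (h.measurable_W ij.1 ij.2) (h.prob_W _ _)]
      exact measureReal_nonneg
    · set a := f (p.linPred ij.1 ij.2) with ha
      set b := f (q.linPred ij.1 ij.2) with hb
      have hpC := hp.abs_linPred_le hC ij.1 ij.2
      have hqC := hq.abs_linPred_le hC ij.1 ij.2
      have ha0 : 0 < a := hf.pos _ hpC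
      have ha1 : a < 1 := hf.lt_one _ hpC
      have hb0 : 0 < b := hf.pos _ hqC
      have hb1 : b < 1 := hf.lt_one _ hqC
      have hH := sqrt_mul_sqrt_add_le hb0 hb1 ha0 ha1
      have hsq : c ^ 2 * (q.linPred ij.1 ij.2 - p.linPred ij.1 ij.2) ^ 2 ≤ (b - a) ^ 2 := by
        rw [← mul_pow, ← sq_abs (b - a), ← sq_abs (c * _), abs_mul, abs_of_nonneg hc0]
        exact pow_le_pow_left₀ (by positivity) (hc _ _ hqC hpC) 2
      have hdiv : ∀ x y : ℝ, 0 < x → x * (√y / √x) = √y * √x := by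
        intro x y hx
        have h1 := Real.sq_sqrt hx.le
        have h2 := Real.sqrt_pos.2 hx
        field_simp
        rw [h1, mul_comm]
      have hE1 : 1 ≤ Real.exp (κ / 2) := Real.one_le_exp (by positivity)
      have e1 := hdiv a b ha0
      have e2 := hdiv (1 - a) (1 - b) (sub_pos.2 ha1)
      have hsum : ∑ z : Bool × Bool, bernProb a z.1 * bernProb ρ z.2 * G ij z.1 z.2 =
          1 + ρ * ((√b * √a + √(1 - b) * √(1 - a)) * Real.exp (κ / 2) - 1) := by
        rw [← e1, ← e2, Fintype.sum_prod_type]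
        simp only [Fintype.sum_bool, bernProb, G, ← ha, ← hb, if_true, Bool.false_eq_true, if_false]
        ring
      rw [hsum, add_comm]
      -- The mean of one factor is `1 + ρ (affinity * exp(κ/2) - 1)`, and `1 + x ≤ exp x`.
      refine le_trans ?_ (Real.add_one_le_exp _)
      refine add_le_add_left (mul_le_mul_of_nonneg_left ?_ hρ0) 1
      have hd : 0 ≤ (b - a) ^ 2 / 8 := by positivity
      have := mul_le_mul_of_nonneg_right hH (zero_le_one.trans hE1)
      nlinarith [mul_nonneg hd (sub_nonneg.2 hE1)]

end Likelihood

/-! ### Covering the feasible set. -/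

section Net

/-- The feasible set has nets of size exponential in the number of persons and items. -/
theorem exists_finset_feasible_net {C : ℝ} (hC : 0 < C) (K : ℕ) {δ : ℝ} (hδ : 0 < δ) :
    ∃ s : ℕ, 0 < s ∧ ∀ N J : ℕ, ∃ T : Finset (Params N J K), T.card ≤ s ^ (N + J) ∧
      (∀ q ∈ T, q.Feasible C) ∧
      ∀ p : Params N J K, p.Feasible C → ∃ q ∈ T, ∀ i j, |p.linPred i j - q.linPred i j| ≤ δ := by
  classical
  let U : Set (Fin K → ℝ) := {v | √(1 + ∑ k, v k ^ 2) ≤ C}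
  let V : Set (ℝ × (Fin K → ℝ)) := {v | √(v.1 ^ 2 + ∑ k, v.2 k ^ 2) ≤ C}
  have hle : ∀ (v : Fin K → ℝ) k, v k ^ 2 ≤ ∑ k, v k ^ 2 := fun v k =>
    Finset.single_le_sum (f := fun k => v k ^ 2) (fun _ _ => sq_nonneg _) (Finset.mem_univ k)
  have hUb : ∀ v ∈ U, ∀ k, |v k| ≤ C := fun v hv k => by
    have := (Real.sqrt_le_left hC.le).1 hv
    exact abs_le_of_sq_le_sq (by linarith [hle v k]) hC.le
  have hVb : ∀ v ∈ V, (∀ k, |v.2 k| ≤ C) ∧ |v.1| ≤ C := fun v hv => by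
    have := (Real.sqrt_le_left hC.le).1 hv
    refine ⟨fun k => abs_le_of_sq_le_sq (by nlinarith [hle v.2 k, sq_nonneg v.1]) hC.le,
      abs_le_of_sq_le_sq ?_ hC.le⟩
    linarith [Finset.sum_nonneg (s := Finset.univ) fun k _ => sq_nonneg (v.2 k)]
  have hU : IsCompact U := (isCompact_closedBall (0 : Fin K → ℝ) C).of_isClosed_subset
    (isClosed_le (by fun_prop) continuous_const) fun v hv => by
      rw [mem_closedBall_zero_iff, pi_norm_le_iff_of_nonneg hC.le]
      exact hUb v hv
  have hV : IsCompact V := (isCompact_closedBall (0 : ℝ × (Fin K → ℝ)) C).of_isClosed_subset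
    (isClosed_le (by fun_prop) continuous_const) fun v hv => by
      rw [mem_closedBall_zero_iff, Prod.norm_def, max_le_iff, pi_norm_le_iff_of_nonneg hC.le]
      exact ⟨(hVb v hv).2, (hVb v hv).1⟩
  -- An error `e` in every coordinate moves the intercept by `e` and each of the `K` products by at
  -- most `2 C e`.
  set e := δ / (1 + 2 * K * C) with he
  have hden : 0 < 1 + 2 * K * C := by positivity
  have he0 : 0 < e := by positivity
  obtain ⟨t, htU, htf, htc⟩ := finite_cover_balls_of_compact hU he0
  obtain ⟨u, huV, huf, huc⟩ := finite_cover_balls_of_compact hV he0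
  have := htf.fintype
  have := huf.fintype
  -- The `+ 1` keeps the base positive when the feasible set is empty.
  refine ⟨Fintype.card t + Fintype.card u + 1, by omega, fun N J => ?_⟩
  let mk : (Fin N → t) × (Fin J → u) → Params N J K := fun x =>
    ⟨fun i => (x.1 i).1, fun j => (x.2 j).1.2, fun j => (x.2 j).1.1⟩
  refine ⟨Finset.univ.image mk, ?_, ?_, ?_⟩
  · refine Finset.card_image_le.trans ?_
    rw [Finset.card_univ, Fintype.card_prod, Fintype.card_fun, Fintype.card_fun, Fintype.card_fin,
      Fintype.card_fin, pow_add]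
    exact Nat.mul_le_mul (Nat.pow_le_pow_left (by omega) _) (Nat.pow_le_pow_left (by omega) _)
  · intro q hq
    obtain ⟨x, -, rfl⟩ := Finset.mem_image.1 hq
    exact ⟨fun i => htU (x.1 i).2, fun j => huV (x.2 j).2⟩
  · intro p hp
    have h1 : ∀ i, ∃ v : t, dist (p.Θ i) v.1 < e := fun i => by
      have := htc (hp.1 i : p.Θ i ∈ U)
      simpa using this
    have h2 : ∀ j, ∃ v : u, dist ((p.d j, p.A j) : ℝ × (Fin K → ℝ)) v.1 < e := fun j => by
      have hv : ((p.d j, p.A j) : ℝ × (Fin K → ℝ)) ∈ V := hp.2 j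
      have := huc hv
      simpa using this
    choose x hx using h1
    choose y hy using h2
    refine ⟨mk (x, y), Finset.mem_image_of_mem _ (Finset.mem_univ _), fun i j => ?_⟩
    have hy' := hy j
    rw [Prod.dist_eq, max_lt_iff] at hy'
    have ht : ∀ k, |p.A j k * p.Θ i k - (y j).1.2 k * (x i).1 k| ≤ 2 * C * e := fun k => by
      have e1 : |p.Θ i k - (x i).1 k| ≤ e := (dist_le_pi_dist _ _ k).trans (hx i).le
      have e2 : |p.A j k - (y j).1.2 k| ≤ e := (dist_le_pi_dist _ _ k).trans hy'.2.le
      have e3 := hUb _ (hp.1 i : p.Θ i ∈ U) k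
      have e4 := (hVb _ (huV (y j).2)).1 k
      have : p.A j k * p.Θ i k - (y j).1.2 k * (x i).1 k =
        (p.A j k - (y j).1.2 k) * p.Θ i k + (y j).1.2 k * (p.Θ i k - (x i).1 k) := by ring
      rw [this]
      refine (abs_add_le _ _).trans ?_
      rw [abs_mul, abs_mul]
      have := mul_le_mul e2 e3 (abs_nonneg _) he0.le
      have := mul_le_mul e4 e1 (abs_nonneg _) hC.le
      linarith
    have hd : |p.d j - (y j).1.1| ≤ e := hy'.1.le
    have hsplit : p.linPred i j - (mk (x, y)).linPred i j = (p.d j - (y j).1.1) +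
        ∑ k, (p.A j k * p.Θ i k - (y j).1.2 k * (x i).1 k) := by
      simp only [Params.linPred, mk, dotProduct, Finset.sum_sub_distrib]
      ring
    rw [hsplit]
    refine (abs_add_le _ _).trans ?_
    have hs := (Finset.abs_sum_le_sum_abs (fun k => p.A j k * p.Θ i k - (y j).1.2 k * (x i).1 k)
      Finset.univ).trans (Finset.sum_le_sum fun k _ => ht k)
    rw [Finset.sum_const, Finset.card_univ, Fintype.card_fin, nsmul_eq_mul] at hs
    have : e * (1 + 2 * K * C) = δ := div_mul_cancel₀ _ hden.ne'
    linarith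

end Net

/-! ### Mean-square recovery of the linear predictors. -/

section Consistency

universe u

/-- The likelihood estimate recovers the matrix of linear predictors in mean square, up to an event
of probability exponentially small in the expected number of observations. -/
theorem exists_measureReal_sum_sq_ge_le {f : ℝ → ℝ} {C : ℝ} (hC : 0 < C) (hf : LinkRegular f C)
    (K : ℕ) {η : ℝ} (hη : 0 < η) :
    ∃ s : ℕ, 0 < s ∧ ∃ r > 0, ∀ (N J : ℕ), 0 < N → 0 < J → ∀ (p : Params N J K), p.Feasible C →
      ∀ (n : ℝ), 0 < n → ∀ (Ω : Type u) [MeasurableSpace Ω] (P : Measure Ω)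
        [IsProbabilityMeasure P] (Y W : Ω → Fin N → Fin J → Bool), IsDataModel P f p n Y W →
      ∀ est : Ω → Params N J K, (∀ ω, IsCJMLE f C (Y ω) (W ω) (est ω)) →
        P.real {ω | η * (N * J) ≤
          ∑ ij : Fin N × Fin J, ((est ω).linPred ij.1 ij.2 - p.linPred ij.1 ij.2) ^ 2} ≤
          (s : ℝ) ^ (N + J) * Real.exp (-(r * n)) := by
  obtain ⟨c, hc0, hc⟩ := hf.exists_mul_abs_sub_le
  obtain ⟨B, hB0, hB⟩ := hf.exists_bernProb_le
  -- A net point near a bad estimate gains `c² η / 16` per expected observation; `δ` is so small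
  -- that slack and discretization cost less than half of this.
  obtain ⟨δ, hδ, hδη⟩ : ∃ δ > 0,
      Real.exp (B * δ / 2) - 1 + c ^ 2 / 8 * δ ^ 2 < c ^ 2 * η / 32 := by
    have hcont : Continuous fun δ : ℝ => Real.exp (B * δ / 2) - 1 + c ^ 2 / 8 * δ ^ 2 := by
      fun_prop
    have h0 : ∀ᶠ δ in 𝓝 (0 : ℝ),
        Real.exp (B * δ / 2) - 1 + c ^ 2 / 8 * δ ^ 2 < c ^ 2 * η / 32 := by
      refine hcont.continuousAt.eventually_lt_const ?_
      simp only [mul_zero, zero_div, Real.exp_zero, sub_self, ne_eq, OfNat.ofNat_ne_zero,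
        not_false_eq_true, zero_pow, add_zero]
      positivity
    obtain ⟨δ, h1, h2⟩ := ((h0.filter_mono nhdsWithin_le_nhds).and
      (self_mem_nhdsWithin (a := (0 : ℝ)) (s := Set.Ioi 0))).exists
    exact ⟨δ, h2, h1⟩
  obtain ⟨s, hs, hnet⟩ := exists_finset_feasible_net hC K hδ
  refine ⟨s, hs, c ^ 2 * η / 32, by positivity, ?_⟩
  intro N J hN hJ p hp n hn Ω _ P _ Y W hdata est hest
  obtain ⟨T, hTcard, hTfeas, hT⟩ := hnet N J
  have hNJ : (0 : ℝ) < (N : ℝ) * J := by positivity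
  have hcard : ∀ a : ℝ, ∑ _ij : Fin N × Fin J, a = N * J * a := fun a => by
    rw [Finset.sum_const, Finset.card_univ, Fintype.card_prod, Fintype.card_fin, Fintype.card_fin,
      nsmul_eq_mul, Nat.cast_mul]
  classical
  set D : Params N J K → ℝ := fun q =>
    ∑ ij : Fin N × Fin J, (q.linPred ij.1 ij.2 - p.linPred ij.1 ij.2) ^ 2 with hD
  -- The threshold comes from `(u + v)² ≤ 2u² + 2v²` with `|u| ≤ δ`.
  set T' := T.filter fun q => (η / 2 - δ ^ 2) * (N * J) ≤ D q with hT'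
  set E : Params N J K → Set Ω := fun q =>
    {ω | likelihood f (Y ω) (W ω) p ≤ likelihood f (Y ω) (W ω) q * slack (B * δ) (W ω)} with hE
  have hsub : {ω | η * (N * J) ≤ D (est ω)} ⊆ ⋃ q ∈ T', E q := by
    intro ω hω
    have hω' : η * (N * J) ≤ D (est ω) := hω
    obtain ⟨q, hqT, hq⟩ := hT (est ω) (hest ω).1
    have hDq : D (est ω) ≤ 2 * D q + N * J * (2 * δ ^ 2) := by
      rw [hD, ← hcard, Finset.mul_sum, ← Finset.sum_add_distrib]
      refine Finset.sum_le_sum fun ij _ => ?_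
      have h1 := sq_le_sq.2 ((hq ij.1 ij.2).trans (le_abs_self δ))
      nlinarith [sq_nonneg ((est ω).linPred ij.1 ij.2 - q.linPred ij.1 ij.2 -
        (q.linPred ij.1 ij.2 - p.linPred ij.1 ij.2))]
    simp only [Set.mem_iUnion]
    refine ⟨q, Finset.mem_filter.2 ⟨hqT, by linarith⟩, ?_⟩
    have hle : likelihood f (Y ω) (W ω) p ≤ likelihood f (Y ω) (W ω) (est ω) :=
      (Real.log_le_log_iff (likelihood_pos hC hf _ _ hp)
        (likelihood_pos hC hf _ _ (hest ω).1)).1 ((hest ω).2 p hp)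
    exact hle.trans (likelihood_le_mul_slack hC hf hB0 hB _ _ (hest ω).1 (hTfeas q hqT) hq)
  have hEle : ∀ q ∈ T', P.real (E q) ≤ Real.exp (-(c ^ 2 * η / 32 * n)) := by
    intro q hq
    obtain ⟨hqT, hqD⟩ := Finset.mem_filter.1 hq
    refine (hdata.measureReal_likelihood_le hn hC hf hc0.le hc (mul_nonneg hB0 hδ.le) hp
      (hTfeas q hqT)).trans (Real.exp_le_exp.2 ?_)
    rw [Finset.sum_sub_distrib, hcard, ← Finset.mul_sum]
    change n / (N * J) * (N * J * (Real.exp (B * δ / 2) - 1) - c ^ 2 / 8 * D q) ≤ _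
    have h1 : N * J * (Real.exp (B * δ / 2) - 1) - c ^ 2 / 8 * D q ≤
        N * J * (-(c ^ 2 * η / 32)) := by
      have := mul_le_mul_of_nonneg_left hqD (by positivity : 0 ≤ c ^ 2 / 8)
      have := mul_le_mul_of_nonneg_left hδη.le hNJ.le
      nlinarith
    refine (mul_le_mul_of_nonneg_left h1 (by positivity)).trans_eq ?_
    field_simp
  calc P.real {ω | η * (N * J) ≤ D (est ω)} ≤ P.real (⋃ q ∈ T', E q) :=
        measureReal_mono hsub (measure_ne_top _ _)
    _ ≤ ∑ q ∈ T', P.real (E q) := measureReal_biUnion_finset_le _ _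
    _ ≤ ∑ _q ∈ T', Real.exp (-(c ^ 2 * η / 32 * n)) := Finset.sum_le_sum hEle
    _ = T'.card * Real.exp (-(c ^ 2 * η / 32 * n)) := by rw [Finset.sum_const, nsmul_eq_mul]
    _ ≤ _ := by
        gcongr
        exact_mod_cast (Finset.card_filter_le _ _).trans hTcard

/-- The exponent is at most `(N + J) (log s - r log(NJ))`, which is below `-N` once `r log(NJ) ≥ log
s + 1`. -/
theorem tendsto_pow_mul_exp_zero {ι : Type*} {l : Filter ι} {N J : ι → ℕ}
    (hN : Tendsto N l atTop) (hJ : Tendsto J l atTop) {n : ι → ℝ}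
    (hn : ∀ t, ((N t : ℝ) + (J t : ℝ)) * Real.log ((J t : ℝ) * (N t : ℝ)) ≤ n t)
    {s : ℕ} (hs : 0 < s) {r : ℝ} (hr : 0 < r) :
    Tendsto (fun t => (s : ℝ) ^ (N t + J t) * Real.exp (-(r * n t))) l (𝓝 0) := by
  have hNr : Tendsto (fun t => (N t : ℝ)) l atTop := tendsto_natCast_atTop_atTop.comp hN
  have hJr : Tendsto (fun t => (J t : ℝ)) l atTop := tendsto_natCast_atTop_atTop.comp hJ
  have hlog := Real.tendsto_log_atTop.comp (hJr.atTop_mul_atTop₀ hNr)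
  have hexp : Tendsto (fun t => Real.exp (-(N t : ℝ))) l (𝓝 0) :=
    Real.tendsto_exp_neg_atTop_nhds_zero.comp hNr
  refine squeeze_zero' (Eventually.of_forall fun t => by positivity) ?_ hexp
  filter_upwards [hlog.eventually_ge_atTop ((Real.log s + 1) / r)] with t ht
  have hs' : (0 : ℝ) < s := by exact_mod_cast hs
  rw [Function.comp_apply, div_le_iff₀ hr] at ht
  have h1 : (s : ℝ) ^ (N t + J t) = Real.exp ((N t + J t) * Real.log s) := by
    rw [← Real.rpow_natCast, Real.rpow_def_of_pos hs']
    push_cast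
    ring_nf
  rw [h1, ← Real.exp_add, Real.exp_le_exp]
  have h2 := mul_le_mul_of_nonneg_left (hn t) hr.le
  have h3 := mul_le_mul_of_nonneg_left ht (by positivity : (0 : ℝ) ≤ N t + J t)
  have : (0 : ℝ) ≤ J t := by positivity
  nlinarith

end Consistency

/-! ### From linear predictors to loadings, in Frobenius norm. -/

section Recovery

attribute [local instance] Matrix.frobeniusNormedAddCommGroup Matrix.frobeniusNormedSpace

theorem frobNorm_eq_norm {m n : ℕ} (X : Matrix (Fin m) (Fin n) ℝ) : frobNorm X = ‖X‖ := by
  rw [Matrix.frobenius_norm_def, frobNorm, Real.sqrt_eq_rpow]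
  simp

theorem norm_sq_eq_sum {m n : ℕ} (X : Matrix (Fin m) (Fin n) ℝ) :
    ‖X‖ ^ 2 = ∑ i, ∑ j, X i j ^ 2 := by
  rw [← frobNorm_eq_norm, frobNorm, Real.sq_sqrt]
  positivity

/-- A matrix whose Gram matrix is close to the identity is close to an orthogonal matrix. -/
theorem exists_orthogonal_near (K : ℕ) (b : ℝ) {ε : ℝ} (hε : 0 < ε) :
    ∃ δ > 0, ∀ R : Matrix (Fin K) (Fin K) ℝ, ‖R‖ ≤ b → ‖1 - Rᵀ * R‖ ≤ δ →
      ∃ Q : Matrix (Fin K) (Fin K) ℝ, Qᵀ * Q = 1 ∧ ‖R - Q‖ ≤ ε := by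
  have := FiniteDimensional.proper ℝ (Matrix (Fin K) (Fin K) ℝ)
  -- On this compact set of matrices far from all orthogonal ones, `‖1 - Rᵀ R‖` has a positive
  -- minimum, since at a zero `R` would itself be orthogonal.
  let S : Set (Matrix (Fin K) (Fin K) ℝ) :=
    Metric.closedBall 0 b ∩ {R | ∀ Q : Matrix (Fin K) (Fin K) ℝ, Qᵀ * Q = 1 → ε ≤ ‖R - Q‖}
  have hS : IsCompact S := by
    refine (isCompact_closedBall _ _).inter_right ?_
    simp only [Set.ofPred_forall]
    exact isClosed_iInter fun Q => isClosed_iInter fun _ =>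
      isClosed_le continuous_const (by fun_prop)
  have hcont : Continuous fun R : Matrix (Fin K) (Fin K) ℝ => ‖1 - Rᵀ * R‖ := by
    refine Continuous.norm ?_
    exact continuous_const.sub (continuous_id.matrix_transpose.matrix_mul continuous_id)
  rcases S.eq_empty_or_nonempty with hempty | hne
  · refine ⟨1, one_pos, fun R hR _ => ?_⟩
    by_contra! hcon
    have : R ∈ S := ⟨mem_closedBall_zero_iff.2 hR, fun Q hQ => (hcon Q hQ).le⟩
    simp [hempty] at this
  · obtain ⟨R₀, hR₀, hmin⟩ := hS.exists_isMinOn hne hcont.continuousOn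
    have hpos : 0 < ‖1 - R₀ᵀ * R₀‖ := by
      rw [norm_pos_iff]
      intro h0
      have := hR₀.2 R₀ (sub_eq_zero.1 h0).symm
      simp at this
      linarith
    refine ⟨‖1 - R₀ᵀ * R₀‖ / 2, by positivity, fun R hR hR' => ?_⟩
    by_contra! hcon
    have : R ∈ S := ⟨mem_closedBall_zero_iff.2 hR, fun Q hQ => (hcon Q hQ).le⟩
    have h2 : ‖1 - R₀ᵀ * R₀‖ ≤ ‖1 - Rᵀ * R‖ := hmin this
    linarith

/-- Expand `v` in an eigenbasis of `T* T`: every eigenvalue is at least the last one, `sigmaK A ^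
2`. For `K > 0` the index `K - 1` is the last. -/
theorem sigmaK_mul_norm_le {J K : ℕ} (hK : 0 < K) (A : Matrix (Fin J) (Fin K) ℝ)
    (v : EuclideanSpace ℝ (Fin K)) : sigmaK A * ‖v‖ ≤ ‖Matrix.toEuclideanLin A v‖ := by
  set T := Matrix.toEuclideanLin A with hT
  have hfr : Module.finrank ℝ (EuclideanSpace ℝ (Fin K)) = K := by simp
  have hS := T.isSymmetric_adjoint_comp_self
  set b := hS.eigenvectorBasis hfr
  have hs0 : 0 ≤ sigmaK A := T.singularValues_nonneg _
  have hlam : ∀ i, sigmaK A ^ 2 ≤ hS.eigenvalues hfr i := by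
    intro i
    rw [sigmaK, ← hT, T.sq_singularValues_of_lt hfr (by omega : K - 1 < K)]
    exact hS.eigenvalues_antitone hfr (Fin.le_def.2 (by simp; omega))
  have hsq : ‖T v‖ ^ 2 = ∑ i, hS.eigenvalues hfr i * (b.repr v i) ^ 2 := by
    have h1 : ‖T v‖ ^ 2 = inner ℝ v ((LinearMap.adjoint T ∘ₗ T) v) := by
      rw [LinearMap.comp_apply, LinearMap.adjoint_inner_right, real_inner_self_eq_norm_sq]
    rw [h1, ← b.repr.inner_map_map, PiLp.inner_apply]
    refine Finset.sum_congr rfl fun i _ => ?_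
    rw [hS.eigenvectorBasis_apply_self_apply hfr v i]
    simp
    ring
  have hv : ‖v‖ ^ 2 = ∑ i, (b.repr v i) ^ 2 := by
    rw [← b.repr.norm_map, EuclideanSpace.norm_sq_eq]
    simp
  refine le_of_sq_le_sq ?_ (norm_nonneg _)
  rw [mul_pow, hsq, hv, Finset.mul_sum]
  exact Finset.sum_le_sum fun i _ => mul_le_mul_of_nonneg_right (hlam i) (sq_nonneg _)

theorem sigmaK_mul_frobenius_le {J K m : ℕ} (hK : 0 < K) (A : Matrix (Fin J) (Fin K) ℝ)
    (B : Matrix (Fin K) (Fin m) ℝ) : sigmaK A * ‖B‖ ≤ ‖A * B‖ := by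
  have hs0 : 0 ≤ sigmaK A := (Matrix.toEuclideanLin A).singularValues_nonneg _
  refine le_of_sq_le_sq ?_ (norm_nonneg _)
  rw [mul_pow, norm_sq_eq_sum, norm_sq_eq_sum, Finset.sum_comm, Finset.sum_comm (γ := Fin J),
    Finset.mul_sum]
  refine Finset.sum_le_sum fun j _ => ?_
  have h := pow_le_pow_left₀ (by positivity)
    (sigmaK_mul_norm_le hK A (WithLp.toLp 2 fun k => B k j)) 2
  rw [mul_pow, EuclideanSpace.norm_sq_eq, EuclideanSpace.norm_sq_eq] at h
  simpa [Matrix.toLpLin_apply, Matrix.mulVec, dotProduct, Matrix.mul_apply] using h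

variable {N J K : ℕ}

theorem Identified.transpose_mul_self (hN : 0 < N) {Θ : Matrix (Fin N) (Fin K) ℝ}
    (h : Identified Θ) : Θᵀ * Θ = (N : ℝ) • (1 : Matrix (Fin K) (Fin K) ℝ) := by
  have hN' : (N : ℝ) ≠ 0 := by positivity
  ext k k'
  rw [Matrix.mul_apply, Matrix.smul_apply, Matrix.one_apply]
  split_ifs with hk
  · subst hk
    have := h.mean_sq_eq_one k
    field_simp at this
    simpa [sq] using this
  · simpa using h.orthogonal k k' hk

theorem Identified.norm_sq (hN : 0 < N) {Θ : Matrix (Fin N) (Fin K) ℝ} (h : Identified Θ) :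
    ‖Θ‖ ^ 2 = N * K := by
  have hN' : (N : ℝ) ≠ 0 := by positivity
  rw [norm_sq_eq_sum, Finset.sum_comm]
  have : ∀ k, ∑ i, Θ i k ^ 2 = N := fun k => by
    have := h.mean_sq_eq_one k
    field_simp at this
    simpa [sq] using this
  simp [this, mul_comm]

/-- The person parameters of an identified model recover the loadings of another model from the
matrix of linear predictors, since the intercepts are annihilated. -/
theorem Identified.linPred_transpose_mul {p : Params N J K} {Θ : Matrix (Fin N) (Fin K) ℝ}
    (h : Identified Θ) : (Matrix.of p.linPred)ᵀ * Θ = p.A * (p.Θᵀ * Θ) := by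
  ext j k
  have h0 := h.sum_eq_zero k
  simp only [Matrix.mul_apply, Matrix.transpose_apply, Matrix.of_apply, Params.linPred, add_mul,
    Finset.sum_add_distrib, ← Finset.mul_sum, h0, mul_zero, zero_add, dotProduct, Finset.sum_mul]
  rw [Finset.sum_comm]
  simp only [Finset.mul_sum, mul_assoc]

/-- Multiply the difference of the transposed predictor matrices by `p.Θ`, whose Gram matrix is `N`
times the identity and whose norm is `√(N K)`. Only `p.Θ` has to be identified. -/
theorem norm_loading_sub_le (hN : 0 < N) {p q : Params N J K} (hp : Identified p.Θ) :
    ‖p.A - q.A * ((N : ℝ)⁻¹ • (q.Θᵀ * p.Θ))‖ ≤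
      √(K / N) * ‖Matrix.of p.linPred - Matrix.of q.linPred‖ := by
  have hN' : (0 : ℝ) < N := by positivity
  have h1 : p.A - q.A * ((N : ℝ)⁻¹ • (q.Θᵀ * p.Θ)) =
      (N : ℝ)⁻¹ • ((Matrix.of p.linPred - Matrix.of q.linPred)ᵀ * p.Θ) := by
    rw [Matrix.transpose_sub, Matrix.sub_mul, hp.linPred_transpose_mul, hp.linPred_transpose_mul,
      hp.transpose_mul_self hN, smul_sub, Matrix.mul_smul, Matrix.mul_smul, smul_smul,
      inv_mul_cancel₀ hN'.ne', one_smul, Matrix.mul_one]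
  have h2 : ‖p.Θ‖ = √(N * K) := by rw [← hp.norm_sq hN, Real.sqrt_sq (norm_nonneg _)]
  rw [h1, norm_smul, Real.norm_of_nonneg (by positivity)]
  have h3 := Matrix.frobenius_norm_mul (Matrix.of p.linPred - Matrix.of q.linPred)ᵀ p.Θ
  rw [Matrix.frobenius_norm_transpose, h2] at h3
  refine (mul_le_mul_of_nonneg_left h3 (by positivity)).trans_eq ?_
  have h4 : √((K : ℝ) / N) = (N : ℝ)⁻¹ * √(N * K) := by
    rw [Real.sqrt_eq_iff_mul_self_eq (by positivity) (by positivity), mul_mul_mul_comm,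
      Real.mul_self_sqrt (by positivity)]
    field_simp
  rw [h4]
  ring

theorem loss_le {A B : Matrix (Fin J) (Fin K) ℝ} {Q : Matrix (Fin K) (Fin K) ℝ}
    (hQ : Qᵀ * Q = 1) : loss A B ≤ 1 / ((J : ℝ) * K) * ‖A - B * Q‖ ^ 2 := by
  rw [← frobNorm_eq_norm]
  exact ciInf_le (f := fun Q : {Q : Matrix (Fin K) (Fin K) ℝ // Qᵀ * Q = 1} =>
    (1 / ((J : ℝ) * (K : ℝ))) * frobNorm (A - B * Q.1) ^ 2)
    ⟨0, by rintro _ ⟨Q, rfl⟩; positivity⟩ ⟨Q, hQ⟩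

theorem Params.Feasible.norm_A_le {C : ℝ} (hC : 0 < C) {p : Params N J K} (h : p.Feasible C) :
    ‖p.A‖ ≤ C * √J := by
  refine le_of_sq_le_sq ?_ (by positivity)
  rw [norm_sq_eq_sum, mul_pow, Real.sq_sqrt (by positivity)]
  calc ∑ j, ∑ k, p.A j k ^ 2 ≤ ∑ _j : Fin J, C ^ 2 := Finset.sum_le_sum fun j _ => by
        have := (Real.sqrt_le_left hC.le).1 (h.2 j)
        linarith [sq_nonneg (p.d j)]
    _ = C ^ 2 * J := by simp [mul_comm]

/-- Two identified models with close linear predictors have close loadings, up to a rotation. -/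
theorem exists_loss_lt (hK : 0 < K) {C C₃ : ℝ} (hC : 0 < C) (hC₃ : 0 < C₃) {ε : ℝ} (hε : 0 < ε) :
    ∃ η > 0, ∀ (N J : ℕ), 0 < N → 0 < J → ∀ p q : Params N J K, p.Feasible C →
      Identified p.Θ → Identified q.Θ → C₃ * √(J : ℝ) ≤ sigmaK p.A →
      ∑ ij : Fin N × Fin J, (q.linPred ij.1 ij.2 - p.linPred ij.1 ij.2) ^ 2 < η * (N * J) →
      loss p.A q.A < ε := by
  have hK' : (1 : ℝ) ≤ K := by exact_mod_cast hK
  have hK0 : (0 : ℝ) < K := by linarith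
  -- The goal is `‖A* - Ã Q‖ ≤ x √J`. Passing from `R` to `Q` costs `C K e ≤ x / 2`, and the terms
  -- `r + r e` cost at most `x / 2`.
  set x := √(ε / 2) with hx
  have hx0 : 0 < x := Real.sqrt_pos.2 (by positivity)
  have hx2 : x ^ 2 = ε / 2 := Real.sq_sqrt (by positivity)
  set e := min 1 (x / (2 * (C * K))) with he
  have he0 : 0 < e := by positivity
  have he1 : e ≤ 1 := min_le_left _ _
  have heC : C * K * e ≤ x / 2 := by
    have := (le_div_iff₀ (by positivity)).1 (min_le_right 1 (x / (2 * (C * K))))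
    rw [← he] at this
    linarith
  obtain ⟨δ, hδ, hnear⟩ := exists_orthogonal_near K K he0
  set r := min (δ * C₃ / (1 + K)) (x / 4) with hr
  have hr0 : 0 < r := by positivity
  have hr1 : r * (1 + K) ≤ δ * C₃ := (le_div_iff₀ (by positivity)).1 (min_le_left _ _)
  have hr2 : r ≤ x / 4 := min_le_right _ _
  refine ⟨r ^ 2 / K, by positivity, ?_⟩
  intro N J hN hJ p q hp hpI hqI hσ hD
  have hN' : (0 : ℝ) < N := by positivity
  have hJ' : (0 : ℝ) < J := by positivity
  have hJs : 0 < √(J : ℝ) := Real.sqrt_pos.2 hJ'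
  set D := ‖Matrix.of p.linPred - Matrix.of q.linPred‖ with hDdef
  have hD2 : D ^ 2 ≤ r ^ 2 / K * (N * J) := by
    rw [hDdef, norm_sub_rev, norm_sq_eq_sum]
    rw [Fintype.sum_prod_type] at hD
    exact hD.le
  have hτ : √(K / N) * D ≤ r * √J := by
    refine le_of_sq_le_sq ?_ (by positivity)
    rw [mul_pow, mul_pow, Real.sq_sqrt (by positivity), Real.sq_sqrt (by positivity)]
    refine (mul_le_mul_of_nonneg_left hD2 (by positivity)).trans_eq ?_
    field_simp
  set R := (N : ℝ)⁻¹ • (q.Θᵀ * p.Θ) with hR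
  have h1 : ‖p.A - q.A * R‖ ≤ r * √J := (norm_loading_sub_le hN hpI).trans hτ
  have h2 : ‖q.A - p.A * Rᵀ‖ ≤ r * √J := by
    have := norm_loading_sub_le hN (q := p) hqI
    rw [norm_sub_rev (Matrix.of q.linPred)] at this
    have hRt : Rᵀ = (N : ℝ)⁻¹ • (p.Θᵀ * q.Θ) := by
      rw [hR, Matrix.transpose_smul, Matrix.transpose_mul, Matrix.transpose_transpose]
    rw [hRt]
    exact this.trans hτ
  have hRK : ‖R‖ ≤ K := by
    rw [hR, norm_smul, Real.norm_of_nonneg (by positivity), inv_mul_le_iff₀ hN']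
    have := Matrix.frobenius_norm_mul q.Θᵀ p.Θ
    rw [Matrix.frobenius_norm_transpose] at this
    nlinarith [hpI.norm_sq hN, hqI.norm_sq hN, sq_nonneg (‖q.Θ‖ - ‖p.Θ‖)]
  have hgram : ‖1 - Rᵀ * R‖ ≤ δ := by
    have e1 : p.A * (1 - Rᵀ * R) = (p.A - q.A * R) + (q.A - p.A * Rᵀ) * R := by
      rw [Matrix.mul_sub, Matrix.sub_mul, Matrix.mul_one, Matrix.mul_assoc]
      abel
    have e2 : ‖p.A * (1 - Rᵀ * R)‖ ≤ r * √J + r * √J * K := by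
      rw [e1]
      refine (norm_add_le _ _).trans (add_le_add h1 ?_)
      exact (Matrix.frobenius_norm_mul _ _).trans
        (mul_le_mul h2 hRK (norm_nonneg _) (by positivity))
    have e3 := (mul_le_mul_of_nonneg_right hσ (norm_nonneg (1 - Rᵀ * R))).trans
      ((sigmaK_mul_frobenius_le hK p.A (1 - Rᵀ * R)).trans e2)
    have e4 : C₃ * √J * ‖1 - Rᵀ * R‖ ≤ C₃ * √J * δ := by nlinarith
    exact le_of_mul_le_mul_left e4 (by positivity)
  obtain ⟨Q, hQ, hRQ⟩ := hnear R hRK hgram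
  -- A standardized estimate need not be feasible, so its loadings are bounded through `Ã ≈ A* Rᵀ`.
  have hqA : ‖q.A‖ ≤ r * √J + C * √J * K := by
    have e1 : q.A = (q.A - p.A * Rᵀ) + p.A * Rᵀ := by abel
    rw [e1]
    refine (norm_add_le _ _).trans (add_le_add h2 ((Matrix.frobenius_norm_mul _ _).trans ?_))
    rw [Matrix.frobenius_norm_transpose]
    exact mul_le_mul (hp.norm_A_le hC) hRK (norm_nonneg _) (by positivity)
  have hfin : ‖p.A - q.A * Q‖ ≤ x * √J := by
    have e1 : p.A - q.A * Q = (p.A - q.A * R) + q.A * (R - Q) := by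
      rw [Matrix.mul_sub]
      abel
    have e2 : ‖q.A * (R - Q)‖ ≤ (r * √J + C * √J * K) * e :=
      (Matrix.frobenius_norm_mul _ _).trans (mul_le_mul hqA hRQ (norm_nonneg _) (by positivity))
    rw [e1]
    refine (norm_add_le _ _).trans ((add_le_add h1 e2).trans ?_)
    have e3 : r * e ≤ r := mul_le_of_le_one_right hr0.le he1
    have e4 : r + r * e + C * K * e ≤ x := by linarith
    nlinarith [mul_le_mul_of_nonneg_right e4 hJs.le]
  calc loss p.A q.A ≤ 1 / ((J : ℝ) * K) * ‖p.A - q.A * Q‖ ^ 2 := loss_le hQ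
    _ ≤ 1 / ((J : ℝ) * K) * (x * √J) ^ 2 := by gcongr
    _ = ε / 2 / K := by
        rw [mul_pow, hx2, Real.sq_sqrt hJ'.le]
        field_simp
    _ ≤ ε / 2 := div_le_self (by positivity) hK'
    _ < ε := by linarith

end Recovery

end IFA

end

/-- The index `t` (with `N t, J t → ∞` along `l`) runs through the models of the asymptotic regime;
the dimension `K`, the link `f` and the constants `C`, `C₃` do not depend on `t`. -/
theorem theorem4
    {K : ℕ} (hK : 0 < K) (f : ℝ → ℝ) (C : ℝ) (hC : 0 < C) (C₃ : ℝ) (hC₃ : 0 < C₃)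
    (hf : IFA.LinkRegular f C)
    {ι : Type*} (l : Filter ι) (N J : ι → ℕ)
    (hN : Tendsto N l atTop) (hJ : Tendsto J l atTop)
    (truth : ∀ t, IFA.Params (N t) (J t) K)
    (hbound : ∀ t, (truth t).Feasible C)
    (hident : ∀ t, IFA.Identified (truth t).Θ)
    (hsigma : ∀ t, C₃ * √(J t : ℝ) ≤ IFA.sigmaK (truth t).A)
    (n : ι → ℝ) (hn_pos : ∀ t, 0 < n t)
    (hn : ∀ t, ((N t : ℝ) + (J t : ℝ)) * Real.log ((J t : ℝ) * (N t : ℝ)) ≤ n t)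
    {Ω : ι → Type*} [∀ t, MeasurableSpace (Ω t)]
    (P : ∀ t, Measure (Ω t)) [∀ t, IsProbabilityMeasure (P t)]
    (Y W : ∀ t, Ω t → Fin (N t) → Fin (J t) → Bool)
    (hdata : ∀ t, IFA.IsDataModel (P t) f (truth t) (n t) (Y t) (W t))
    (est std : ∀ t, Ω t → IFA.Params (N t) (J t) K)
    (hest : ∀ t ω, IFA.IsCJMLE f C (Y t ω) (W t ω) (est t ω))
    (hstd : ∀ t ω, IFA.IsStandardization (est t ω) (std t ω)) :
    ∀ ε : ℝ, 0 < ε →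
      Tendsto (fun t => P t {ω | ε ≤ IFA.loss (truth t).A (std t ω).A}) l (𝓝 0) := by
  intro ε hε
  obtain ⟨η, hη, hloss⟩ := IFA.exists_loss_lt hK hC hC₃ hε
  obtain ⟨s, hs, r, hr, hbd⟩ := IFA.exists_measureReal_sum_sq_ge_le hC hf K hη
  have hlim := ENNReal.tendsto_ofReal (IFA.tendsto_pow_mul_exp_zero hN hJ hn hs hr)
  rw [ENNReal.ofReal_zero] at hlim
  refine tendsto_of_tendsto_of_tendsto_of_le_of_le' tendsto_const_nhds hlim
    (Eventually.of_forall fun _ => zero_le) ?_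
  filter_upwards [hN.eventually_gt_atTop 0, hJ.eventually_gt_atTop 0] with t hNt hJt
  have hsub : {ω | ε ≤ IFA.loss (truth t).A (std t ω).A} ⊆
      {ω | η * (N t * J t) ≤ ∑ ij : Fin (N t) × Fin (J t),
        ((est t ω).linPred ij.1 ij.2 - (truth t).linPred ij.1 ij.2) ^ 2} := by
    intro ω hω
    have hω' : ε ≤ IFA.loss (truth t).A (std t ω).A := hω
    change η * (N t * J t) ≤ ∑ ij : Fin (N t) × Fin (J t),
        ((est t ω).linPred ij.1 ij.2 - (truth t).linPred ij.1 ij.2) ^ 2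
    by_contra! hcon
    refine absurd (hloss (N t) (J t) hNt hJt (truth t) (std t ω) (hbound t) (hident t)
      (hstd t ω).1 (hsigma t) ?_) (not_lt.2 hω')
    -- Standardization preserves the linear predictors, so the bound for `est` is one for `std`.
    simpa only [(hstd t ω).2] using hcon
  refine (measure_mono hsub).trans ?_
  rw [← ofReal_measureReal]
  exact ENNReal.ofReal_le_ofReal (hbd (N t) (J t) hNt hJt (truth t) (hbound t) (n t) (hn_pos t)
    (Ω t) (P t) (Y t) (W t) (hdata t) (est t) (hest t))
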